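/- Let $k$ be a commutative ring, and let $\otimes=\otimes_k$. Algebras are associative $k$-algebras, not necessarily with unit. For an algebra $R$ and a left $R$-module $M$, let $R\otimes_R M$ be the quotient of $R\otimes M$ by the relations $rs\otimes m=r\otimes sm$; $M$ is called unital if the canonical map $R\otimes_R M\to M$, $r\otimes m\mapsto rm$, is an isomorphism. The algebra $A$ is called unital if $A\otimes_A A\to A$ is an isomorphism. Put $A^{e}=A\otimes A^{op}$, which acts on $A$ by $(a\otimes a')\cdot x=axa'$. A Taylor–Azumaya algebra is a unital algebra $A$, faithful as a $k$-module, such that the functor $F(N)=A\otimes N$ from $k$-modules to unital left $A^{e}$-modules and its right adjoint $H_l(M)=\mathrm{Hom}_{A^{e}}(A,M)$ are inverse equivalences, i.e. the maps $N\to\mathrm{Hom}_{A^{e}}(A,A\otimes N)$, $n\mapsto(a\mapsto a\otimes n)$, and $A\otimes\mathrm{Hom}_{A^{e}}(A,M)\to M$, $a\otimes f\mapsto f(a)$, are isomorphisms for all $k$-modules $N$ and all unital left $A^{e}$-modules $M$. Let $G$ be a group (finite or infinite) acting on a Taylor–Azumaya algebra $A$ by $k$-algebra automorphisms. Let $A\#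 kG$ be the smash product, that is, $A\otimes kG$ with the multiplication $(a\# g)(b\# h)=a(g\cdot b)\# gh$, viewed as a left $A^{e}$-module by $(a\otimes a')\cdot(b\# g)=ab(g\cdot a')\# g$. **Lemma 3.1.** The $k$-module $S=H_l(A\# kG)=\mathrm{Hom}_{A^{e}}(A,A\# kG)$ is an associative $k$-algebra with unit, with multiplication determined by $$(\varphi\psi)(ab)=\varphi(a)\psi(b)\qquad(\varphi,\psi\in S,\ a,b\in A)$$ and unit $a\mapsto a\# 1$. It is $G$-graded, $S=\bigoplus_{g\in G}S_g$, where $S_g$ consists of the $\varphi\in S$ with $\varphi(A)\subseteq A\# g$. With this structure $S$ is a $kG$-Galois object: the canonical map $$\gamma:\ S\otimes S\to S\otimes kG,\qquad \gamma(s\otimes t)=\sum_{g\in G}s\,t_g\otimes g,$$ is an isomorphism, $S$ is strongly graded, i.e. $S_gS_h=S_{gh}$ for all $g,h\in G$, and $S_e=k$, i.e. $k\to S$ is injective with image $S_e$. -/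

import Mathlib

open scoped TensorProduct

universe u

noncomputable section

set_option linter.unusedSectionVars false

namespace TaylorAzumaya

/-! ### Modules over algebras that need not have a unit

A left module over a `k`-algebra `R` (associative, not necessarily with unit) is a `k`-module `M`
together with a multiplicative `k`-linear map `ρ : R → End_k(M)`; `r · m` is `ρ r m`. -/

section Modules

variable {k : Type*} [CommRing k]
variable {R : Type*} [NonUnitalRing R] [Module k R] [SMulCommClass k R R] [IsScalarTower k R R]
variable {M : Type*} [AddCommGroup M] [Module k M]
variable {N : Type*} [AddCommGroup N] [Module k N]

/-- The relations `r s ⊗ m = r ⊗ s · m` that cut `R ⊗_R M` out of `R ⊗_k M`. -/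
def balancedRelations (ρ : R →ₙₐ[k] Module.End k M) : Submodule k (R ⊗[k] M) :=
  Submodule.span k {x | ∃ (r s : R) (m : M), x = (r * s) ⊗ₜ[k] m - r ⊗ₜ[k] (ρ s m)}

/-- The tensor product `R ⊗_R M` of a left `R`-module `M`. -/
abbrev BalancedTensor (ρ : R →ₙₐ[k] Module.End k M) : Type _ :=
  (R ⊗[k] M) ⧸ balancedRelations ρ

/-- The map `R ⊗_k M → M`, `r ⊗ m ↦ r · m`. -/
def actionMap (ρ : R →ₙₐ[k] Module.End k M) : R ⊗[k] M →ₗ[k] M :=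
  TensorProduct.lift (ρ : R →ₗ[k] Module.End k M)

@[simp]
theorem actionMap_tmul (ρ : R →ₙₐ[k] Module.End k M) (r : R) (m : M) :
    actionMap ρ (r ⊗ₜ[k] m) = ρ r m := rfl

theorem balancedRelations_le_ker (ρ : R →ₙₐ[k] Module.End k M) :
    balancedRelations ρ ≤ LinearMap.ker (actionMap ρ) := by
  refine Submodule.span_le.2 ?_
  rintro _ ⟨r, s, m, rfl⟩
  simp

/-- The canonical map `R ⊗_R M → M`, `r ⊗ m ↦ r · m`. -/
def canonicalAction (ρ : R →ₙₐ[k] Module.End k M) : BalancedTensor ρ →ₗ[k] M :=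
  (balancedRelations ρ).liftQ (actionMap ρ) (balancedRelations_le_ker ρ)

/-- A left `R`-module `M` is unital if `R ⊗_R M → M` is an isomorphism. -/
def IsUnitalModule (ρ : R →ₙₐ[k] Module.End k M) : Prop :=
  Function.Bijective (canonicalAction ρ)

/-- `Hom_R(M, N)`, as a `k`-module. -/
def homOver (ρ : R →ₙₐ[k] Module.End k M) (σ : R →ₙₐ[k] Module.End k N) :
    Submodule k (M →ₗ[k] N) where
  carrier := {f | ∀ r m, f (ρ r m) = σ r (f m)}
  add_mem' := fun hf hg r m => by simp [hf r m, hg r m]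
  zero_mem' := fun r m => by simp
  smul_mem' := fun c f hf r m => by simp [hf r m]

/-- The left `R`-module `M ⊗_k N` with `r · (m ⊗ n) = r · m ⊗ n`. -/
def tensorModule (ρ : R →ₙₐ[k] Module.End k M) (N : Type*) [AddCommGroup N] [Module k N] :
    R →ₙₐ[k] Module.End k (M ⊗[k] N) where
  toFun r := (ρ r).rTensor N
  map_smul' c r := by simp [LinearMap.rTensor_smul]
  map_zero' := by simp
  map_add' r s := by simp [LinearMap.rTensor_add]
  map_mul' r s := by rw [map_mul]; exact LinearMap.rTensor_comp _ _ _

end Modules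

/-! ### Unital algebras, the enveloping algebra, bimodules -/

section Envelope

variable (k : Type*) [CommRing k]
variable (A : Type*) [NonUnitalRing A] [Module k A] [SMulCommClass k A A] [IsScalarTower k A A]

/-- `A` as a left module over itself. -/
def leftRegular : A →ₙₐ[k] Module.End k A where
  toFun a := LinearMap.mulLeft k a
  map_smul' c a := by ext; simp [smul_mul_assoc]
  map_zero' := by ext; simp
  map_add' a b := by ext; simp [add_mul]
  map_mul' a b := by ext; simp

/-- A (not necessarily unitary) `k`-algebra `A` is a unital algebra if the canonical map
`A ⊗_A A → A` is an isomorphism. -/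
class IsUnitalAlgebra : Prop where
  unital : IsUnitalModule (leftRegular k A)

/-- The enveloping algebra `Aᵉ = A ⊗ Aᵒᵖ`. -/
abbrev Env : Type _ := A ⊗[k] Aᵐᵒᵖ

variable {k A}
variable {S : Type*} [NonUnitalRing S] [Module k S] [SMulCommClass k S S] [IsScalarTower k S S]

/-- An algebra map `η : A → S` makes `S` a left `Aᵉ`-module: `(a ⊗ a') · s = η(a) s η(a')`. -/
def envModule (η : A →ₙₐ[k] S) : Env k A →ₙₐ[k] Module.End k S where
  toFun := TensorProduct.lift (LinearMap.mk₂ k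
    (fun (a : A) (b : Aᵐᵒᵖ) => LinearMap.mulLeft k (η a) * LinearMap.mulRight k (η b.unop))
    (fun a a' b => by ext; simp [add_mul])
    (fun c a b => by ext; simp [smul_mul_assoc])
    (fun a b b' => by ext; simp [mul_add])
    (fun c a b => by ext; simp [mul_smul_comm]))
  map_smul' c x := by simp
  map_zero' := by simp
  map_add' x y := by simp
  map_mul' x y := by
    induction x using TensorProduct.induction_on with
    | zero => simp
    | add x x' hx hx' => rw [add_mul, map_add, map_add, hx, hx', add_mul]
    | tmul a b =>
      induction y using TensorProduct.induction_on with
      | zero => simp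
      | add y y' hy hy' => rw [mul_add, map_add, map_add, hy, hy', mul_add]
      | tmul a' b' => ext s; simp [mul_assoc]

@[simp]
theorem envModule_tmul (η : A →ₙₐ[k] S) (a : A) (b : Aᵐᵒᵖ) (s : S) :
    envModule η (a ⊗ₜ[k] b) s = η a * (s * η b.unop) := rfl

variable (k A) in
/-- `A_l`: the algebra `A` as a left `Aᵉ`-module, `(a ⊗ a') · x = a x a'`. -/
abbrev selfModule : Env k A →ₙₐ[k] Module.End k A := envModule (NonUnitalAlgHom.id k A)

end Envelope

/-! ### Taylor-Azumaya algebras -/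

section TaylorAzumaya

variable (k : Type u) [CommRing k]
variable (A : Type u) [NonUnitalRing A] [Module k A] [SMulCommClass k A A] [IsScalarTower k A A]

/-- The unit `N → H_l(F(N)) = Hom_{Aᵉ}(A, A ⊗ N)`, `n ↦ (a ↦ a ⊗ n)`, of the adjoint pair
`F = A_l ⊗ -`, `H_l = Hom_{Aᵉ}(A_l, -)`. -/
def adjUnit (N : Type*) [AddCommGroup N] [Module k N] :
    N →ₗ[k] homOver (selfModule k A) (tensorModule (selfModule k A) N) :=
  LinearMap.codRestrict _ (TensorProduct.mk k A N).flip fun _ _ _ => rfl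

/-- The counit `F(H_l(M)) = A ⊗ Hom_{Aᵉ}(A, M) → M`, `a ⊗ f ↦ f(a)`. -/
def adjCounit {M : Type*} [AddCommGroup M] [Module k M] (ρ : Env k A →ₙₐ[k] Module.End k M) :
    A ⊗[k] homOver (selfModule k A) ρ →ₗ[k] M :=
  TensorProduct.lift (homOver (selfModule k A) ρ).subtype.flip

theorem adjUnit_apply {N : Type*} [AddCommGroup N] [Module k N] (n : N) (a : A) :
    (adjUnit k A N n).1 a = a ⊗ₜ[k] n := rfl

theorem adjCounit_tmul {M : Type*} [AddCommGroup M] [Module k M]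
    (ρ : Env k A →ₙₐ[k] Module.End k M) (a : A) (f : homOver (selfModule k A) ρ) :
    adjCounit k A ρ (a ⊗ₜ[k] f) = f.1 a := rfl

/-- Taylor-Azumaya algebras: unital, faithful `k`-algebras `A` such that the adjoint functors
`F = A_l ⊗ -`, from `k`-modules to unital left `Aᵉ`-modules, and `H_l = Hom_{Aᵉ}(A_l, -)` are
inverse equivalences, that is, the unit and the counit of the adjunction are isomorphisms. -/
class IsTaylorAzumaya : Prop extends IsUnitalAlgebra k A where
  faithful : FaithfulSMul k A
  unit_bijective : ∀ (N : Type u) [AddCommGroup N] [Module k N],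
    Function.Bijective (adjUnit k A N)
  counit_bijective : ∀ (M : Type u) [AddCommGroup M] [Module k M]
    (ρ : Env k A →ₙₐ[k] Module.End k M), IsUnitalModule ρ →
      Function.Bijective (adjCounit k A ρ)

end TaylorAzumaya

/-! ### The algebra `Hom_{Aᵉ}(A, S)` of an algebra map `A → S`, for `A` unital -/

section HomAlgebra

variable {k : Type*} [CommRing k]
variable {A : Type*} [NonUnitalRing A] [Module k A] [SMulCommClass k A A] [IsScalarTower k A A]
variable {S : Type*} [NonUnitalRing S] [Module k S] [SMulCommClass k S S] [IsScalarTower k S S]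

/-- `Hom_{Aᵉ}(A, S)`, for `S` an `Aᵉ`-module through an algebra map `η : A → S`. -/
abbrev EnvHom (η : A →ₙₐ[k] S) : Type _ := ↥(homOver (selfModule k A) (envModule η))

variable [hA : IsUnitalAlgebra k A]

/-- `A² = A`. -/
theorem span_mul_eq_top (k : Type*) [CommRing k]
    (A : Type*) [NonUnitalRing A] [Module k A] [SMulCommClass k A A] [IsScalarTower k A A]
    [hA : IsUnitalAlgebra k A] :
    Submodule.span k {x : A | ∃ a b, x = a * b} = ⊤ := by
  refine eq_top_iff.2 fun x _ => ?_
  obtain ⟨y, rfl⟩ := hA.unital.2 x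
  obtain ⟨t, rfl⟩ := Submodule.Quotient.mk_surjective _ y
  change actionMap _ t ∈ _
  induction t with
  | zero => simp
  | add s t hs ht => rw [map_add]; exact add_mem (hs trivial) (ht trivial)
  | tmul a b => exact Submodule.subset_span ⟨a, b, rfl⟩

/-- Two linear maps that agree on products agree. -/
theorem linearMap_ext_mul {M : Type*} [AddCommGroup M] [Module k M] {f g : A →ₗ[k] M}
    (h : ∀ a b, f (a * b) = g (a * b)) : f = g := by
  refine LinearMap.ext_on (span_mul_eq_top k A) ?_
  rintro _ ⟨a, b, rfl⟩
  exact h a b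

theorem EnvHom.map_mul_mul {η : A →ₙₐ[k] S} (φ : EnvHom η) (a x b : A) :
    φ.1 (a * (x * b)) = η a * (φ.1 x * η b) :=
  φ.2 (a ⊗ₜ[k] MulOpposite.op b) x

theorem EnvHom.map_mul_left {η : A →ₙₐ[k] S} (φ : EnvHom η) (a b : A) :
    φ.1 (a * b) = η a * φ.1 b := by
  have h : φ.1 ∘ₗ LinearMap.mulLeft k a = LinearMap.mulLeft k (η a) ∘ₗ φ.1 := by
    refine linearMap_ext_mul fun x y => ?_
    have key : φ.1 ∘ₗ LinearMap.mulLeft k a ∘ₗ LinearMap.mulRight k y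
        = LinearMap.mulLeft k (η a) ∘ₗ φ.1 ∘ₗ LinearMap.mulRight k y := by
      refine linearMap_ext_mul fun p q => ?_
      have h1 := φ.map_mul_mul (a * p) q y
      have h2 := φ.map_mul_mul p q y
      simp only [map_mul, mul_assoc] at h1 h2
      simp [mul_assoc, h1, h2]
    exact LinearMap.congr_fun key x
  exact LinearMap.congr_fun h b

theorem EnvHom.map_mul_right {η : A →ₙₐ[k] S} (φ : EnvHom η) (a b : A) :
    φ.1 (a * b) = φ.1 a * η b := by
  have h : φ.1 ∘ₗ LinearMap.mulRight k b = LinearMap.mulRight k (η b) ∘ₗ φ.1 := by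
    refine linearMap_ext_mul fun x y => ?_
    have h1 := φ.map_mul_mul x y b
    simp [mul_assoc, h1, φ.map_mul_left]
  exact LinearMap.congr_fun h a

/-- The `k`-linear isomorphism `A ⊗_A A ≅ A`. -/
def unitalEquiv (k : Type*) [CommRing k]
    (A : Type*) [NonUnitalRing A] [Module k A] [SMulCommClass k A A] [IsScalarTower k A A]
    [hA : IsUnitalAlgebra k A] : BalancedTensor (leftRegular k A) ≃ₗ[k] A :=
  LinearEquiv.ofBijective (canonicalAction (leftRegular k A)) hA.unital

theorem unitalEquiv_symm_mul (a b : A) :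
    (unitalEquiv k A).symm (a * b) = Submodule.Quotient.mk (a ⊗ₜ[k] b) := by
  rw [LinearEquiv.symm_apply_eq]; rfl

/-- The map `A ⊗_k A → S`, `a ⊗ b ↦ φ(a) ψ(b)`. -/
def preMul (f g : A →ₗ[k] S) : A ⊗[k] A →ₗ[k] S :=
  TensorProduct.lift ((LinearMap.mul k S).compl₁₂ f g)

theorem preMul_le_ker {η : A →ₙₐ[k] S} (φ ψ : EnvHom η) :
    balancedRelations (leftRegular k A) ≤ LinearMap.ker (preMul φ.1 ψ.1) := by
  refine Submodule.span_le.2 ?_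
  rintro _ ⟨a, b, c, rfl⟩
  simp [preMul, leftRegular, φ.map_mul_right, ψ.map_mul_left, mul_assoc]

/-- The map `A → S` that sends `∑ aᵢ aᵢ'` to `∑ φ(aᵢ) ψ(aᵢ')`. -/
def mulFun {η : A →ₙₐ[k] S} (φ ψ : EnvHom η) : A →ₗ[k] S :=
  (balancedRelations (leftRegular k A)).liftQ (preMul φ.1 ψ.1) (preMul_le_ker φ ψ) ∘ₗ
    (unitalEquiv k A).symm.toLinearMap

theorem mulFun_mul {η : A →ₙₐ[k] S} (φ ψ : EnvHom η) (a b : A) :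
    mulFun φ ψ (a * b) = φ.1 a * ψ.1 b := by
  simp [mulFun, unitalEquiv_symm_mul, preMul]

theorem mulFun_mem {η : A →ₙₐ[k] S} (φ ψ : EnvHom η) :
    mulFun φ ψ ∈ homOver (selfModule k A) (envModule η) := by
  intro r
  suffices h : mulFun φ ψ ∘ₗ selfModule k A r = envModule η r ∘ₗ mulFun φ ψ from
    LinearMap.congr_fun h
  induction r using TensorProduct.induction_on with
  | zero => simp
  | add x y hx hy => rw [map_add, map_add, LinearMap.comp_add, LinearMap.add_comp, hx, hy]
  | tmul a b =>
    refine linearMap_ext_mul fun x y => ?_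
    have h1 := mulFun_mul φ ψ (a * x) (y * b.unop)
    have h2 := mulFun_mul φ ψ x y
    simp only [mul_assoc] at h1
    simp [mul_assoc, h1, h2, φ.map_mul_left, ψ.map_mul_right]

/-- The product of `Hom_{Aᵉ}(A, S)`: `(φ ψ)(∑ aᵢ aᵢ') = ∑ φ(aᵢ) ψ(aᵢ')`. -/
instance (η : A →ₙₐ[k] S) : Mul (EnvHom η) where
  mul φ ψ := ⟨mulFun φ ψ, mulFun_mem φ ψ⟩

/-- The unit of `Hom_{Aᵉ}(A, S)` is `η`. -/
instance (η : A →ₙₐ[k] S) : One (EnvHom η) where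
  one := ⟨(η : A →ₗ[k] S), fun r => by
    suffices h : (η : A →ₗ[k] S) ∘ₗ selfModule k A r = envModule η r ∘ₗ (η : A →ₗ[k] S) from
      LinearMap.congr_fun h
    induction r using TensorProduct.induction_on with
    | zero => simp
    | add x y hx hy => rw [map_add, map_add, LinearMap.comp_add, LinearMap.add_comp, hx, hy]
    | tmul a b => ext x; simp⟩

theorem EnvHom.mul_apply_mul {η : A →ₙₐ[k] S} (φ ψ : EnvHom η) (a b : A) :
    (φ * ψ).1 (a * b) = φ.1 a * ψ.1 b := mulFun_mul φ ψ a b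

theorem EnvHom.one_apply {η : A →ₙₐ[k] S} (a : A) : (1 : EnvHom η).1 a = η a := rfl

theorem EnvHom.ext_mul {η : A →ₙₐ[k] S} {φ ψ : EnvHom η}
    (h : ∀ a b, φ.1 (a * b) = ψ.1 (a * b)) : φ = ψ :=
  Subtype.ext (linearMap_ext_mul h)

instance (η : A →ₙₐ[k] S) : Ring (EnvHom η) :=
  { (inferInstance : AddCommGroup (EnvHom η)) with
    mul := (· * ·)
    one := 1
    left_distrib := fun φ ψ χ => EnvHom.ext_mul fun a b => by
      change (φ * (ψ + χ)).1 _ = (φ * ψ).1 _ + (φ * χ).1 _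
      simp only [EnvHom.mul_apply_mul]; exact mul_add _ _ _
    right_distrib := fun φ ψ χ => EnvHom.ext_mul fun a b => by
      change ((φ + ψ) * χ).1 _ = (φ * χ).1 _ + (ψ * χ).1 _
      simp only [EnvHom.mul_apply_mul]; exact add_mul _ _ _
    zero_mul := fun φ => EnvHom.ext_mul fun a b => by
      change ((0 : EnvHom η) * φ).1 _ = 0
      rw [EnvHom.mul_apply_mul]; exact zero_mul _
    mul_zero := fun φ => EnvHom.ext_mul fun a b => by
      change (φ * (0 : EnvHom η)).1 _ = 0
      rw [EnvHom.mul_apply_mul]; exact mul_zero _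
    mul_assoc := fun φ ψ χ => by
      change φ * ψ * χ = φ * (ψ * χ)
      refine Subtype.ext (linearMap_ext_mul fun a c => ?_)
      rw [EnvHom.mul_apply_mul, EnvHom.mul_apply_mul]
      have h : LinearMap.mulRight k (χ.1 c) ∘ₗ (φ * ψ).1
          = (φ * (ψ * χ)).1 ∘ₗ LinearMap.mulRight k c := by
        refine linearMap_ext_mul fun x y => ?_
        simp [EnvHom.mul_apply_mul, mul_assoc]
      have h' := LinearMap.congr_fun h a
      simp only [LinearMap.comp_apply, LinearMap.mulRight_apply] at h'
      rw [h', EnvHom.mul_apply_mul]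
    one_mul := fun φ => EnvHom.ext_mul fun a b => by
      change (1 * φ).1 _ = φ.1 _
      rw [EnvHom.mul_apply_mul, EnvHom.one_apply, φ.map_mul_left]
    mul_one := fun φ => EnvHom.ext_mul fun a b => by
      change (φ * 1).1 _ = φ.1 _
      rw [EnvHom.mul_apply_mul, EnvHom.one_apply, φ.map_mul_right] }

instance (η : A →ₙₐ[k] S) : Algebra k (EnvHom η) :=
  Algebra.ofModule
    (fun c φ ψ => EnvHom.ext_mul fun a b => by
      change ((c • φ) * ψ).1 _ = c • (φ * ψ).1 _
      simp only [EnvHom.mul_apply_mul]; exact smul_mul_assoc _ _ _)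
    (fun c φ ψ => EnvHom.ext_mul fun a b => by
      change (φ * (c • ψ)).1 _ = c • (φ * ψ).1 _
      simp only [EnvHom.mul_apply_mul]; exact mul_smul_comm _ _ _)

end HomAlgebra

/-! ### `G`-module algebras and the smash product -/

section Smash

/-- `G` acts on the `k`-algebra `A` by `k`-algebra automorphisms. -/
class IsModuleAlgebra (k : Type*) [CommRing k] (A : Type*) [NonUnitalRing A] [Module k A]
    (G : Type*) [Group G] [DistribMulAction G A] : Prop extends SMulCommClass G k A where
  smul_mul : ∀ (g : G) (a b : A), g • (a * b) = (g • a) * (g • b)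

variable (k : Type*) [CommRing k]
variable (A : Type*) [NonUnitalRing A] [Module k A]
variable (G : Type*)

/-- The smash product `A # kG`; as a `k`-module it is `A ⊗ kG`, that is, the finite formal sums
`∑ a_g # g`. The base ring `k` is recorded in the type only for the sake of the instances. -/
def Smash (_k : Type*) (A : Type*) [NonUnitalRing A] (G : Type*) : Type _ := G →₀ A

namespace Smash

instance : AddCommGroup (Smash k A G) := inferInstanceAs (AddCommGroup (G →₀ A))

instance : Module k (Smash k A G) := inferInstanceAs (Module k (G →₀ A))

variable {A G}

/-- The element `a # g`. -/
def of (g : G) : A →ₗ[k] Smash k A G := Finsupp.lsingle g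

theorem induction_on {p : Smash k A G → Prop} (x : Smash k A G) (zero : p 0)
    (add : ∀ x y, p x → p y → p (x + y)) (of : ∀ g a, p (of k g a)) : p x :=
  Finsupp.induction_linear x zero add of

/-- The linear map `A # kG → M` with given restrictions to the summands `A # g`. -/
def lift {M : Type*} [AddCommGroup M] [Module k M] (f : G → A →ₗ[k] M) : Smash k A G →ₗ[k] M :=
  Finsupp.lsum k f

@[simp]
theorem lift_of {M : Type*} [AddCommGroup M] [Module k M] (f : G → A →ₗ[k] M) (g : G) (a : A) :
    lift k f (of k g a) = f g a :=
  Finsupp.lsum_single k f g a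

variable [Group G] [DistribMulAction G A]
variable [SMulCommClass k A A] [IsScalarTower k A A] [IsModuleAlgebra k A G]

variable (A G) in
/-- The multiplication of the smash product, as a bilinear map. -/
def mulMap : Smash k A G →ₗ[k] Smash k A G →ₗ[k] Smash k A G :=
  lift k fun g : G => LinearMap.flip (lift k fun h : G =>
    LinearMap.mk₂ k (fun (b a : A) => of k (g * h) (a * (g • b)))
      (fun b b' a => by simp [mul_add])
      (fun c b a => by simp [smul_comm g c b, mul_smul_comm])
      (fun b a a' => by simp [add_mul])
      (fun c b a => by simp [smul_mul_assoc]))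

instance : Mul (Smash k A G) where
  mul x y := mulMap k A G x y

/-- `(a # g)(b # h) = a (g · b) # g h`. -/
theorem of_mul_of (g h : G) (a b : A) :
    of k g a * of k h b = of k (g * h) (a * (g • b)) := by
  change mulMap k A G _ _ = _
  simp [mulMap]

theorem mulMap_assoc (x y z : Smash k A G) :
    mulMap k A G (mulMap k A G x y) z = mulMap k A G x (mulMap k A G y z) := by
  refine induction_on k (p := fun x => mulMap k A G (mulMap k A G x y) z =
    mulMap k A G x (mulMap k A G y z)) x ?_ (fun x x' hx hx' => ?_) fun g a => ?_
  · simp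
  · rw [map_add, LinearMap.add_apply, map_add, LinearMap.add_apply, hx, hx', LinearMap.add_apply]
  refine induction_on k (p := fun y => mulMap k A G (mulMap k A G (of k g a) y) z =
    mulMap k A G (of k g a) (mulMap k A G y z)) y ?_ (fun y y' hy hy' => ?_) fun h b => ?_
  · simp
  · rw [map_add, map_add, LinearMap.add_apply, hy, hy', map_add, LinearMap.add_apply, map_add]
  refine induction_on k (p := fun z => mulMap k A G (mulMap k A G (of k g a) (of k h b)) z =
    mulMap k A G (of k g a) (mulMap k A G (of k h b) z)) z ?_ (fun z z' hz hz' => ?_) fun l c => ?_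
  · simp
  · rw [map_add, hz, hz', map_add, map_add]
  change of k g a * of k h b * of k l c = of k g a * (of k h b * of k l c)
  simp only [of_mul_of, mul_assoc, IsModuleAlgebra.smul_mul k, mul_smul]

instance : NonUnitalRing (Smash k A G) :=
  { (inferInstance : AddCommGroup (Smash k A G)) with
    mul := (· * ·)
    left_distrib := fun x y z => map_add (mulMap k A G x) y z
    right_distrib := fun x y z => LinearMap.map_add₂ (mulMap k A G) x y z
    zero_mul := fun x => LinearMap.map_zero₂ (mulMap k A G) x
    mul_zero := fun x => map_zero (mulMap k A G x)
    mul_assoc := mulMap_assoc k }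

instance : SMulCommClass k (Smash k A G) (Smash k A G) where
  smul_comm c x y := (map_smul (mulMap k A G x) c y).symm

instance : IsScalarTower k (Smash k A G) (Smash k A G) where
  smul_assoc c x y := LinearMap.map_smul₂ (mulMap k A G) c x y

variable (A G) in
/-- The algebra map `η : A → A # kG`, `a ↦ a # 1`. -/
def incl : A →ₙₐ[k] Smash k A G where
  toFun a := of k 1 a
  map_smul' c a := map_smul _ c a
  map_zero' := map_zero _
  map_add' a b := map_add _ a b
  map_mul' a b := by simp [of_mul_of]

/-- The `Aᵉ`-module structure of `A # kG` is `(a ⊗ a') · (b # g) = a b (g · a') # g`. -/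
theorem envModule_incl (a b : A) (a' : Aᵐᵒᵖ) (g : G) :
    envModule (incl k A G) (a ⊗ₜ[k] a') (of k g b) = of k g (a * b * (g • a'.unop)) := by
  change of k 1 a * (of k g b * of k 1 a'.unop) = _
  simp [of_mul_of, mul_assoc]

end Smash

variable [Group G] [DistribMulAction G A]
variable [SMulCommClass k A A] [IsScalarTower k A A] [IsModuleAlgebra k A G]

/-- `H_l(A # kG) = Hom_{Aᵉ}(A, A # kG)`. -/
abbrev Hl : Type _ := EnvHom (Smash.incl k A G)

/-- The part of degree `g` of `H_l(A # kG)`: the maps `f` with `f(A) ⊆ A # g`. -/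
def Hl.degree (g : G) : Submodule k (Hl k A G) where
  carrier := {f | ∀ a, f.1 a ∈ LinearMap.range (Smash.of k (A := A) g)}
  add_mem' := fun hf hf' a => add_mem (hf a) (hf' a)
  zero_mem' := fun _ => zero_mem _
  smul_mem' := fun c _ hf a => Submodule.smul_mem _ c (hf a)

end Smash

/-! ### Galois objects -/

section Galois

variable {k : Type*} [CommRing k] {G : Type*} [Group G] [DecidableEq G]
variable {S : Type*} [Ring S] [Algebra k S]

/-- `S = ⨁_g 𝒮 g` is a `G`-graded `k`-algebra. -/
structure IsGrading (𝒮 : G → Submodule k S) : Prop where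
  isInternal : DirectSum.IsInternal 𝒮
  one_mem : (1 : S) ∈ 𝒮 1
  mul_mem : ∀ {g h : G} {s t : S}, s ∈ 𝒮 g → t ∈ 𝒮 h → s * t ∈ 𝒮 (g * h)

/-- The decomposition of the elements of a graded algebra into homogeneous components. -/
def IsGrading.decompose {𝒮 : G → Submodule k S} (h𝒮 : IsGrading 𝒮) :
    S ≃ₗ[k] DirectSum G fun g => 𝒮 g :=
  (LinearEquiv.ofBijective (DirectSum.coeLinearMap 𝒮) h𝒮.isInternal).symm

variable {𝒮 : G → Submodule k S} (h𝒮 : IsGrading 𝒮)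

/-- The coaction `S → S ⊗ kG`, `t ↦ ∑_g t_g ⊗ g`, of a `G`-graded algebra. -/
def coaction : S →ₗ[k] S ⊗[k] MonoidAlgebra k G :=
  DirectSum.toModule k G _ (fun g =>
    (TensorProduct.mk k S (MonoidAlgebra k G)).flip (MonoidAlgebra.single g 1) ∘ₗ
      (𝒮 g).subtype) ∘ₗ h𝒮.decompose.toLinearMap

/-- The canonical map `γ : S ⊗ S → S ⊗ kG`, `γ(s ⊗ t) = ∑_g s t_g ⊗ g`. -/
def galoisMap : S ⊗[k] S →ₗ[k] S ⊗[k] MonoidAlgebra k G :=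
  TensorProduct.lift (LinearMap.mk₂ k
    (fun s t => (LinearMap.mulLeft k s).rTensor (MonoidAlgebra k G) (coaction h𝒮 t))
    (fun s s' t => by
      rw [← LinearMap.add_apply, ← LinearMap.rTensor_add]; congr 2; ext; simp [add_mul])
    (fun c s t => by
      rw [← LinearMap.smul_apply, ← LinearMap.rTensor_smul]; congr 2; ext; simp)
    (fun s t t' => by rw [map_add, map_add])
    (fun c s t => by rw [map_smul, map_smul]))

/-- On a homogeneous `t` of degree `g`, `γ(s ⊗ t) = s t ⊗ g`. -/
theorem galoisMap_tmul_of_mem (s : S) {t : S} {g : G} (ht : t ∈ 𝒮 g) :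
    galoisMap h𝒮 (s ⊗ₜ[k] t) = (s * t) ⊗ₜ[k] MonoidAlgebra.single g (1 : k) := by
  have h : coaction h𝒮 t = t ⊗ₜ[k] MonoidAlgebra.single g (1 : k) := by
    have hd : h𝒮.decompose t = DirectSum.lof k G (fun g => 𝒮 g) g ⟨t, ht⟩ := by
      rw [IsGrading.decompose, LinearEquiv.symm_apply_eq]
      exact (DirectSum.coeLinearMap_lof 𝒮 g ⟨t, ht⟩).symm
    simp only [coaction, LinearMap.comp_apply, LinearEquiv.coe_coe, hd]
    exact DirectSum.toModule_lof k g _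
  simp [galoisMap, h]

/-- `kG`-Galois objects: `G`-graded algebras `S` with bijective canonical map
`γ : S ⊗ S → S ⊗ kG`, which are strongly graded with `k` as part of degree `e`. -/
structure IsGaloisObject (𝒮 : G → Submodule k S) : Prop extends IsGrading 𝒮 where
  bijective : Function.Bijective (galoisMap toIsGrading)
  strongly_graded : ∀ g h : G, 𝒮 g * 𝒮 h = 𝒮 (g * h)
  injective_algebraMap : Function.Injective (algebraMap k S)
  degree_one : 𝒮 1 = LinearMap.range (Algebra.linearMap k S)

end Galois

end TaylorAzumaya

end

/-! The Taylor–Azumaya equivalence turns questions about submodules of `S = Hom_{Aᵉ}(A, A # kG)`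
into questions about values in `A # kG`. Once `A # kG` is known to be a unital `Aᵉ`-module
(`Smash.isUnitalModule_envModule_incl`), a map whose values all lie in the span of the values of a
submodule `P` of `S` belongs to `P` itself (`EnvHom.mem_of_forall_apply_mem_valueSpan`). Since `A #
kG` is the direct sum of its submodules `A # g`, and the maps of degree `g` have values spanning `A
# g` (`Hl.of_mem_valueSpan`), this one criterion yields three facts: the degrees exhaust `S`, `S_g
S_h = S_{gh}`, and `S_e = k`.

Bijectivity of `γ` is then formal for a strongly graded algebra with `S_e = k`
(`galoisMap_bijective`). Writing `1 = ∑ uᵢ vᵢ` with `uᵢ` of degree `g⁻¹` and `vᵢ` of degree `g`, the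
inverse sends `s ⊗ g` to `∑ s uᵢ ⊗ vᵢ`. -/

noncomputable section

set_option linter.unusedSectionVars false

namespace TaylorAzumaya

/-! ### Balanced maps and the tensor product `Aᵉ ⊗_{Aᵉ} S` -/

section Balanced

variable {k : Type*} [CommRing k]
variable {A : Type*} [NonUnitalRing A] [Module k A] [SMulCommClass k A A] [IsScalarTower k A A]
variable [hA : IsUnitalAlgebra k A]

/-- A balanced bilinear map on a unital algebra factors through the multiplication. -/
theorem exists_linearMap_mul_of_balanced {M : Type*} [AddCommGroup M] [Module k M]
    (B : A →ₗ[k] A →ₗ[k] M) (hB : ∀ a s b, B (a * s) b = B a (s * b)) :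
    ∃ f : A →ₗ[k] M, ∀ a b, f (a * b) = B a b := by
  have h : balancedRelations (leftRegular k A) ≤ LinearMap.ker (TensorProduct.lift B) := by
    refine Submodule.span_le.2 ?_
    rintro _ ⟨a, s, b, rfl⟩
    simp [leftRegular, hB]
  refine ⟨(balancedRelations (leftRegular k A)).liftQ (TensorProduct.lift B) h ∘ₗ
    (unitalEquiv k A).symm.toLinearMap, fun a b => ?_⟩
  simp [unitalEquiv_symm_mul]

variable {S : Type*} [NonUnitalRing S] [Module k S] [SMulCommClass k S S] [IsScalarTower k S S]

/-- The map `A → A → Aᵉ ⊗_{Aᵉ} S`, `a, c ↦ (a ⊗ c) ⊗ m`. -/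
def envClass (η : A →ₙₐ[k] S) (m : S) : A →ₗ[k] A →ₗ[k] BalancedTensor (envModule η) :=
  LinearMap.mk₂ k
    (fun a c => (balancedRelations (envModule η)).mkQ ((a ⊗ₜ[k] MulOpposite.op c) ⊗ₜ[k] m))
    (fun a a' c => by simp only [TensorProduct.add_tmul, map_add])
    (fun r a c => by simp only [← TensorProduct.smul_tmul', map_smul])
    (fun a c c' => by
      simp only [MulOpposite.op_add, TensorProduct.tmul_add, TensorProduct.add_tmul, map_add])
    (fun r a c => by
      simp only [MulOpposite.op_smul, TensorProduct.tmul_smul, ← TensorProduct.smul_tmul',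
        map_smul])

theorem envClass_apply (η : A →ₙₐ[k] S) (m : S) (a c : A) : envClass η m a c =
    (balancedRelations (envModule η)).mkQ ((a ⊗ₜ[k] MulOpposite.op c) ⊗ₜ[k] m) := rfl

theorem envClass_add (η : A →ₙₐ[k] S) (m m' : S) :
    envClass η (m + m') = envClass η m + envClass η m' := by
  ext a c
  simp only [LinearMap.add_apply, envClass_apply, TensorProduct.tmul_add, map_add]

theorem envClass_smul (η : A →ₙₐ[k] S) (r : k) (m : S) :
    envClass η (r • m) = r • envClass η m := by
  ext a c
  simp only [LinearMap.smul_apply, envClass_apply, TensorProduct.tmul_smul, map_smul]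

theorem envClass_mul_mul (η : A →ₙₐ[k] S) (m : S) (a s c t : A) :
    envClass η m (a * s) (t * c) = envClass η (η s * (m * η t)) a c := by
  rw [envClass_apply, envClass_apply, ← sub_eq_zero, ← map_sub, ← LinearMap.mem_ker,
    Submodule.ker_mkQ]
  exact Submodule.subset_span ⟨a ⊗ₜ MulOpposite.op c, s ⊗ₜ MulOpposite.op t, m, by simp⟩

/-- Without a unit in `A` the element `s ⊗ 1` of `Aᵉ` is not available, so the defining relation
moves factors only on both sides at once. As `A² = A`, one may take `a = a₁a₂` and `c = c₁c₂`; the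
spare factors `a₂` and `c₁` then cross together with `s` and come back without it. -/
theorem envClass_mul_left (η : A →ₙₐ[k] S) (m : S) (a s c : A) :
    envClass η m (a * s) c = envClass η (η s * m) a c := by
  suffices h : (envClass η m).comp (LinearMap.mulRight k s) = envClass η (η s * m) from
    LinearMap.congr_fun₂ h a c
  refine linearMap_ext_mul fun a₁ a₂ => linearMap_ext_mul fun c₁ c₂ => ?_
  simp only [LinearMap.comp_apply, LinearMap.mulRight_apply]
  rw [mul_assoc, envClass_mul_mul, envClass_mul_mul, map_mul]
  simp only [mul_assoc]

theorem envClass_mul_right (η : A →ₙₐ[k] S) (m : S) (a c t : A) :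
    envClass η m a (t * c) = envClass η (m * η t) a c := by
  suffices h : (envClass η m).flip.comp (LinearMap.mulLeft k t) = (envClass η (m * η t)).flip from
    LinearMap.congr_fun₂ h c a
  refine linearMap_ext_mul fun c₁ c₂ => linearMap_ext_mul fun a₁ a₂ => ?_
  simp only [LinearMap.comp_apply, LinearMap.mulLeft_apply, LinearMap.flip_apply]
  rw [← mul_assoc, envClass_mul_mul, envClass_mul_mul, map_mul]
  simp only [mul_assoc]

end Balanced

/-! ### Spans of values of bimodule maps -/

section ValueSpan

variable {k : Type*} [CommRing k]
variable {A : Type*} [NonUnitalRing A] [Module k A] [SMulCommClass k A A] [IsScalarTower k A A]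
variable {S : Type*} [NonUnitalRing S] [Module k S] [SMulCommClass k S S] [IsScalarTower k S S]

/-- The submodule of `S` spanned by the values of the maps in `P`. -/
def EnvHom.valueSpan {η : A →ₙₐ[k] S} (P : Submodule k (EnvHom η)) : Submodule k S :=
  Submodule.span k {x | ∃ u ∈ P, ∃ b, x = u.1 b}

variable {η : A →ₙₐ[k] S} {P Q : Submodule k (EnvHom η)}

theorem EnvHom.apply_mem_valueSpan {u : EnvHom η} (hu : u ∈ P) (b : A) :
    u.1 b ∈ EnvHom.valueSpan P :=
  Submodule.subset_span ⟨u, hu, b, rfl⟩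

theorem EnvHom.valueSpan_mono (h : P ≤ Q) : EnvHom.valueSpan P ≤ EnvHom.valueSpan Q :=
  Submodule.span_mono fun _ ⟨u, hu, b, hx⟩ => ⟨u, h hu, b, hx⟩

theorem EnvHom.mul_mem_valueSpan [IsUnitalAlgebra k A] {x y : S} (hx : x ∈ EnvHom.valueSpan P)
    (hy : y ∈ EnvHom.valueSpan Q) : x * y ∈ EnvHom.valueSpan (P * Q) := by
  induction hx using Submodule.span_induction with
  | zero => rw [zero_mul]; exact zero_mem _
  | add x x' _ _ hx hx' => rw [add_mul]; exact add_mem hx hx'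
  | smul c x _ hx => rw [smul_mul_assoc]; exact Submodule.smul_mem _ c hx
  | mem x hx =>
    obtain ⟨u, hu, b, rfl⟩ := hx
    induction hy using Submodule.span_induction with
    | zero => rw [mul_zero]; exact zero_mem _
    | add y y' _ _ hy hy' => rw [mul_add]; exact add_mem hy hy'
    | smul c y _ hy => rw [mul_smul_comm]; exact Submodule.smul_mem _ c hy
    | mem y hy =>
      obtain ⟨v, hv, c, rfl⟩ := hy
      rw [← EnvHom.mul_apply_mul]
      have h : u * v ∈ P * Q := Submodule.mul_mem_mul hu hv
      exact EnvHom.apply_mem_valueSpan h (b * c)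

end ValueSpan

/-! ### Detecting membership through values -/

section Detect

variable {k : Type u} [CommRing k]
variable {A : Type u} [NonUnitalRing A] [Module k A] [SMulCommClass k A A] [IsScalarTower k A A]
variable {S : Type u} [NonUnitalRing S] [Module k S] [SMulCommClass k S S] [IsScalarTower k S S]
variable [hA : IsTaylorAzumaya k A]

/-- If `envModule η` is a unital module, membership in a submodule `P` of `Hom_{Aᵉ}(A, S)` can be
tested on values. -/
theorem EnvHom.mem_of_forall_apply_mem_valueSpan {η : A →ₙₐ[k] S} (hη : IsUnitalModule (envModule η))
    (P : Submodule k (EnvHom η)) (t : EnvHom η)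
    (h : ∀ a, t.1 a ∈ EnvHom.valueSpan P) : t ∈ P := by
  have hc := hA.counit_bijective S (envModule η) hη
  -- Every element of the span is the image under the counit of a tensor that dies in `A ⊗
  -- (Hom_{Aᵉ}(A, S) / P)`. Working with this kernel instead of `A ⊗ P` avoids any flatness of `A`.
  have hle : EnvHom.valueSpan P ≤
      (LinearMap.ker (P.mkQ.lTensor A)).map (adjCounit k A (envModule η)) := by
    refine Submodule.span_le.2 ?_
    rintro _ ⟨u, hu, b, rfl⟩
    refine ⟨b ⊗ₜ u, ?_, rfl⟩
    simp [(Submodule.Quotient.mk_eq_zero P).2 hu]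
  rw [← Submodule.Quotient.mk_eq_zero]
  refine (hA.unit_bijective (EnvHom η ⧸ P)).1 (Subtype.ext (LinearMap.ext fun a => ?_))
  obtain ⟨z, hz, hza⟩ := hle (h a)
  -- Both tensors have counit value `t(a)`, so `a ⊗ t` dies in `A ⊗ (Hom_{Aᵉ}(A, S) / P)`. This
  -- holds for every `a`, and injectivity of the adjunction unit at the quotient kills the class of
  -- `t`.
  have hza' : z = a ⊗ₜ t := hc.1 hza
  subst hza'
  rw [map_zero]
  exact hz

end Detect

/-! ### Projections and unitality of the smash product -/

namespace Smash

variable (k : Type*) [CommRing k]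
variable {A : Type*} [NonUnitalRing A] [Module k A]
variable {G : Type*}

theorem hom_ext {M : Type*} [AddCommGroup M] [Module k M] {f f' : Smash k A G →ₗ[k] M}
    (h : ∀ g a, f (of k g a) = f' (of k g a)) : f = f' := by
  ext x
  induction x using induction_on with
  | zero => simp
  | add x y hx hy => simp [hx, hy]
  | of g a => exact h g a

/-- The projection of `A # kG` onto the summand `A # g`. -/
def proj [DecidableEq G] (g : G) : Smash k A G →ₗ[k] Smash k A G :=
  lift k fun h => if h = g then of k g else 0

@[simp]
theorem proj_of_self [DecidableEq G] (g : G) (a : A) : proj k g (of k g a) = of k g a := by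
  simp [proj]

theorem proj_of_ne [DecidableEq G] {g h : G} (hgh : h ≠ g) (a : A) :
    proj k g (of k h a) = 0 := by
  simp [proj, hgh]

theorem proj_mem [DecidableEq G] (g : G) (x : Smash k A G) :
    proj k g x ∈ LinearMap.range (of k (A := A) g) := by
  induction x using induction_on with
  | zero => simp
  | add x y hx hy => rw [map_add]; exact add_mem hx hy
  | of h a =>
    rcases eq_or_ne h g with rfl | hgh
    · exact ⟨a, by simp⟩
    · rw [proj_of_ne k hgh]; exact zero_mem _

variable [Group G] [DistribMulAction G A]
variable [SMulCommClass k A A] [IsScalarTower k A A] [IsModuleAlgebra k A G]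

/-- Each `A # g` is an `Aᵉ`-submodule, so composing with a projection preserves `Hom_{Aᵉ}(A, A #
kG)`. -/
theorem proj_envModule [DecidableEq G] (g : G) (r : Env k A) (x : Smash k A G) :
    proj k g (envModule (incl k A G) r x) = envModule (incl k A G) r (proj k g x) := by
  suffices h : proj k g ∘ₗ envModule (incl k A G) r = envModule (incl k A G) r ∘ₗ proj k g from
    LinearMap.congr_fun h x
  induction r using TensorProduct.induction_on with
  | zero => simp
  | add r s hr hs => rw [map_add, LinearMap.comp_add, LinearMap.add_comp, hr, hs]
  | tmul a b =>
    refine hom_ext k fun h c => ?_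
    rcases eq_or_ne h g with rfl | hgh
    · simp only [LinearMap.comp_apply, envModule_incl, proj_of_self]
    · simp only [LinearMap.comp_apply, envModule_incl, proj_of_ne k hgh, map_zero]

/-- `A # kG` is a unital `Aᵉ`-module. -/
theorem isUnitalModule_envModule_incl [IsUnitalAlgebra k A] :
    IsUnitalModule (envModule (incl k A G)) := by
  -- `χ` is the inverse on `A # g`: since `(a ⊗ c') · (b # g) = a b (g · c') # g`, the preimage of
  -- `abc # g` must use `c' = g⁻¹ · c`. It descends along `A ⊗ A ⊗ A → A` in two stages, balancing
  -- first between `a` and `b`, then between `ab` and `c`.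
  have key (g : G) : ∃ χ : A →ₗ[k] BalancedTensor (envModule (incl k A G)), ∀ a b c : A,
      χ (a * b * c) = envClass (incl k A G) (of k g b) a (g⁻¹ • c) := by
    let B : A →ₗ[k] A →ₗ[k] A →ₗ[k] BalancedTensor (envModule (incl k A G)) :=
      LinearMap.mk₂ k
        (fun a b => envClass (incl k A G) (of k g b) a ∘ₗ DistribSMul.toLinearMap k A g⁻¹)
        (fun a a' b => by rw [map_add, LinearMap.add_comp])
        (fun r a b => by rw [map_smul, LinearMap.smul_comp])
        (fun a b b' => by rw [map_add, envClass_add, LinearMap.add_apply, LinearMap.add_comp])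
        (fun r a b => by rw [map_smul, envClass_smul, LinearMap.smul_apply, LinearMap.smul_comp])
    have hBdef (a b c : A) : B a b c = envClass (incl k A G) (of k g b) a (g⁻¹ • c) := rfl
    obtain ⟨f, hf⟩ := exists_linearMap_mul_of_balanced B fun a s b => by
      ext c
      have h : incl k A G s * of k g b = of k g (s * b) := by
        change of k 1 s * of k g b = _
        simp [of_mul_of]
      rw [hBdef, hBdef, envClass_mul_left, h]
    obtain ⟨χ, hχ⟩ := exists_linearMap_mul_of_balanced f fun x s c => by
      suffices h : f.flip c ∘ₗ LinearMap.mulRight k s = f.flip (s * c) from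
        LinearMap.congr_fun h x
      refine linearMap_ext_mul fun a b => ?_
      have h : of k g b * incl k A G (g⁻¹ • s) = of k g (b * s) := by
        change of k g b * of k 1 (g⁻¹ • s) = _
        simp [of_mul_of]
      simp only [LinearMap.comp_apply, LinearMap.mulRight_apply, LinearMap.flip_apply]
      rw [mul_assoc, hf, hf, hBdef, hBdef, IsModuleAlgebra.smul_mul k, envClass_mul_right, h]
    exact ⟨χ, fun a b c => by rw [hχ, hf, hBdef]⟩
  choose χ hχ using key
  have h₁ (a b c : A) (g : G) : canonicalAction (envModule (incl k A G))
      (envClass (incl k A G) (of k g b) a c) = of k g (a * b * (g • c)) :=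
    envModule_incl k a b (MulOpposite.op c) g
  have hleft : lift k χ ∘ₗ canonicalAction (envModule (incl k A G)) = LinearMap.id := by
    refine Submodule.linearMap_qext _ (TensorProduct.ext' fun r x => ?_)
    change lift k χ (canonicalAction _ ((balancedRelations _).mkQ (r ⊗ₜ x))) =
      (balancedRelations _).mkQ (r ⊗ₜ x)
    induction r using TensorProduct.induction_on with
    | zero => simp only [TensorProduct.zero_tmul, map_zero]
    | add r s hr hs => simp only [TensorProduct.add_tmul, map_add, hr, hs]
    | tmul a c =>
      induction x using induction_on with
      | zero => simp only [TensorProduct.tmul_zero, map_zero]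
      | add x y hx hy => simp only [TensorProduct.tmul_add, map_add, hx, hy]
      | of g b =>
        change lift k χ (canonicalAction _ (envClass _ (of k g b) a c.unop)) =
          envClass _ (of k g b) a c.unop
        rw [h₁, lift_of, hχ, inv_smul_smul]
  have hright : canonicalAction (envModule (incl k A G)) ∘ₗ lift k χ = LinearMap.id := by
    refine hom_ext k fun g x => ?_
    suffices h : canonicalAction (envModule (incl k A G)) ∘ₗ χ g = of k g from by
      simpa using LinearMap.congr_fun h x
    refine linearMap_ext_mul fun y c => ?_
    suffices h : canonicalAction (envModule (incl k A G)) ∘ₗ χ g ∘ₗ LinearMap.mulRight k c =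
        of k g ∘ₗ LinearMap.mulRight k c from LinearMap.congr_fun h y
    refine linearMap_ext_mul fun a b => ?_
    simp only [LinearMap.comp_apply, LinearMap.mulRight_apply]
    rw [hχ, h₁, smul_inv_smul]
  exact Function.bijective_iff_has_inverse.2
    ⟨lift k χ, LinearMap.congr_fun hleft, LinearMap.congr_fun hright⟩

end Smash

/-! ### Homogeneous components and independence of the degrees -/

namespace Hl

variable {k : Type*} [CommRing k]
variable {A : Type*} [NonUnitalRing A] [Module k A]
variable {G : Type*} [Group G] [DistribMulAction G A]
variable [SMulCommClass k A A] [IsScalarTower k A A] [IsModuleAlgebra k A G]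

theorem mul_mem_degree [IsUnitalAlgebra k A] {g h : G} {φ ψ : Hl k A G} (hφ : φ ∈ degree k A G g)
    (hψ : ψ ∈ degree k A G h) : φ * ψ ∈ degree k A G (g * h) := by
  have hle : Submodule.span k {x : A | ∃ a b, x = a * b} ≤
      (LinearMap.range (Smash.of k (A := A) (g * h))).comap (φ * ψ).1 := by
    refine Submodule.span_le.2 ?_
    rintro _ ⟨a, b, rfl⟩
    obtain ⟨x, hx⟩ := hφ a
    obtain ⟨y, hy⟩ := hψ b
    refine ⟨x * g • y, ?_⟩
    rw [EnvHom.mul_apply_mul, ← hx, ← hy, Smash.of_mul_of]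
  rw [span_mul_eq_top] at hle
  exact fun a => hle trivial

theorem one_mem_degree [IsUnitalAlgebra k A] : (1 : Hl k A G) ∈ degree k A G 1 :=
  fun a => ⟨a, rfl⟩

section Component

variable [DecidableEq G]

variable (k A) in
/-- The component of degree `g` of an element of `H_l(A # kG)`. -/
def component (g : G) : Hl k A G →ₗ[k] Hl k A G :=
  LinearMap.codRestrict _ ((Smash.proj k g).compRight k ∘ₗ Submodule.subtype _)
    fun φ r m => by
      change Smash.proj k g (φ.1 _) = envModule _ r (Smash.proj k g (φ.1 m))
      rw [φ.2 r m, Smash.proj_envModule]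

theorem component_apply (g : G) (φ : Hl k A G) (a : A) :
    (component k A g φ).1 a = Smash.proj k g (φ.1 a) := rfl

theorem component_mem (g : G) (φ : Hl k A G) : component k A g φ ∈ degree k A G g :=
  fun _ => Smash.proj_mem k g _

theorem component_of_mem {g : G} {φ : Hl k A G} (hφ : φ ∈ degree k A G g) :
    component k A g φ = φ := by
  refine Subtype.ext (LinearMap.ext fun a => ?_)
  obtain ⟨x, hx⟩ := hφ a
  rw [component_apply, ← hx, Smash.proj_of_self]

theorem component_of_mem_of_ne {g h : G} (hgh : h ≠ g) {φ : Hl k A G}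
    (hφ : φ ∈ degree k A G h) : component k A g φ = 0 := by
  refine Subtype.ext (LinearMap.ext fun a => ?_)
  obtain ⟨x, hx⟩ := hφ a
  rw [component_apply, ← hx, Smash.proj_of_ne k hgh]
  rfl

theorem iSupIndep_degree : iSupIndep (degree k A G) := by
  intro g
  rw [Submodule.disjoint_def]
  intro φ hφ hφ'
  have hle : (⨆ (h) (_ : h ≠ g), degree k A G h) ≤ LinearMap.ker (component k A g) :=
    iSup₂_le fun h hgh ψ hψ => component_of_mem_of_ne hgh hψ
  rw [← component_of_mem hφ]
  exact hle hφ'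

end Component

end Hl

/-! ### Grading, strong grading and the part of degree `e` -/

namespace Hl

variable {k : Type u} [CommRing k]
variable {A : Type u} [NonUnitalRing A] [Module k A]
variable {G : Type u} [Group G] [DistribMulAction G A]
variable [SMulCommClass k A A] [IsScalarTower k A A] [IsModuleAlgebra k A G]
variable [hA : IsTaylorAzumaya k A]

theorem mem_of_forall_apply_mem_valueSpan (P : Submodule k (Hl k A G)) (φ : Hl k A G)
    (h : ∀ a, φ.1 a ∈ EnvHom.valueSpan P) : φ ∈ P :=
  have hη : IsUnitalModule (envModule (Smash.incl k A G)) := Smash.isUnitalModule_envModule_incl k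
  EnvHom.mem_of_forall_apply_mem_valueSpan hη P φ h

/-- The values of the maps of degree `g` span `A # g`. -/
theorem of_mem_valueSpan [DecidableEq G] (g : G) (x : A) :
    Smash.of k g x ∈ EnvHom.valueSpan (degree k A G g) := by
  -- Surjectivity of the counit writes `x # g` as a sum of values `φ(a)`; projecting to `A # g`
  -- replaces each `φ` by its component of degree `g`.
  obtain ⟨z, hz⟩ := (hA.counit_bijective _ _
    (Smash.isUnitalModule_envModule_incl (A := A) (G := G) k)).2 (Smash.of k g x)
  rw [← Smash.proj_of_self k g x, ← hz]
  clear hz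
  induction z using TensorProduct.induction_on with
  | zero => simp
  | add y z hy hz => rw [map_add, map_add]; exact add_mem hy hz
  | tmul a φ => exact EnvHom.apply_mem_valueSpan (component_mem g φ) a

/-- For infinite `G` it is not evident that a map has only finitely many nonzero components. The
value criterion settles this, because each single value is a finite sum of elements of the `A # g`.
-/
theorem iSup_degree [DecidableEq G] : ⨆ g, degree k A G g = ⊤ := by
  refine eq_top_iff.2 fun φ _ => mem_of_forall_apply_mem_valueSpan _ φ fun a => ?_
  induction φ.1 a using Smash.induction_on with
  | zero => exact zero_mem _
  | add x y hx hy => exact add_mem hx hy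
  | of g x => exact EnvHom.valueSpan_mono (le_iSup (degree k A G) g) (of_mem_valueSpan g x)

theorem isGrading_degree [DecidableEq G] : IsGrading (degree k A G) where
  isInternal := (DirectSum.isInternal_submodule_iff_iSupIndep_and_iSup_eq_top _).2
    ⟨iSupIndep_degree, iSup_degree⟩
  one_mem := one_mem_degree
  mul_mem := mul_mem_degree

theorem degree_mul_degree [DecidableEq G] (g h : G) :
    degree k A G g * degree k A G h = degree k A G (g * h) := by
  refine le_antisymm (Submodule.mul_le.2 fun φ hφ ψ hψ => mul_mem_degree hφ hψ) fun φ hφ => ?_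
  refine mem_of_forall_apply_mem_valueSpan _ φ fun a => ?_
  obtain ⟨x, hxa⟩ := hφ a
  rw [← hxa]
  clear hxa
  have hx' : x ∈ Submodule.span k {x : A | ∃ a b, x = a * b} := by
    rw [span_mul_eq_top]; trivial
  induction hx' using Submodule.span_induction with
  | zero => rw [map_zero]; exact zero_mem _
  | add x y _ _ hx hy => rw [map_add]; exact add_mem hx hy
  | smul c x _ hx => rw [map_smul]; exact Submodule.smul_mem _ c hx
  | mem x hx =>
    obtain ⟨y, z, rfl⟩ := hx
    -- The twist by `g⁻¹` cancels the action of `g` in the smash product.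
    have hyz : Smash.of k (g * h) (y * z) = Smash.of k g y * Smash.of k h (g⁻¹ • z) := by
      rw [Smash.of_mul_of, smul_inv_smul]
    rw [hyz]
    exact EnvHom.mul_mem_valueSpan (of_mem_valueSpan g y) (of_mem_valueSpan h (g⁻¹ • z))

theorem algebraMap_injective : Function.Injective (algebraMap k (Hl k A G)) := by
  refine (injective_iff_map_eq_zero _).2 fun c hc => ?_
  have := hA.faithful
  refine eq_of_smul_eq_smul (α := A) fun a => ?_
  have h : (algebraMap k (Hl k A G) c).1 a = Smash.of k 1 (c • a) := by
    rw [Algebra.algebraMap_eq_smul_one]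
    exact (map_smul (Smash.of k (1 : G)) c a).symm
  rw [hc] at h
  rw [zero_smul]
  exact (Finsupp.single_eq_zero.1 h.symm)

/-- The values `a # 1` of the unit already fill `A # 1`, so the value criterion puts every map of
degree `e` into `k · 1`. -/
theorem degree_one [DecidableEq G] :
    degree k A G 1 = LinearMap.range (Algebra.linearMap k (Hl k A G)) := by
  refine le_antisymm (fun φ hφ => ?_) ?_
  · refine mem_of_forall_apply_mem_valueSpan _ φ fun a => ?_
    obtain ⟨x, hx⟩ := hφ a
    rw [← hx]
    have h : (1 : Hl k A G) ∈ LinearMap.range (Algebra.linearMap k (Hl k A G)) :=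
      ⟨1, map_one (algebraMap k (Hl k A G))⟩
    exact EnvHom.apply_mem_valueSpan h x
  · rintro _ ⟨c, rfl⟩
    rw [Algebra.linearMap_apply, Algebra.algebraMap_eq_smul_one]
    exact Submodule.smul_mem _ c one_mem_degree

end Hl

/-! ### Strongly graded algebras with `S_e = k` are Galois -/

section Galois

variable {k : Type*} [CommRing k] {G : Type*} [Group G] [DecidableEq G]
variable {S : Type*} [Ring S] [Algebra k S]
variable {𝒮 : G → Submodule k S} (h𝒮 : IsGrading 𝒮)

theorem IsGrading.hom_ext {M : Type*} [AddCommGroup M] [Module k M] (h𝒮 : IsGrading 𝒮)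
    {f f' : S →ₗ[k] M} (h : ∀ g, ∀ t ∈ 𝒮 g, f t = f' t) : f = f' := by
  ext t
  have ht : t ∈ ⨆ g, 𝒮 g := by rw [h𝒮.isInternal.submodule_iSup_eq_top]; trivial
  exact (iSup_le h : ⨆ g, 𝒮 g ≤ LinearMap.eqLocus f f') ht

theorem galoisMap_bijective (hmul : ∀ g h, 𝒮 g * 𝒮 h = 𝒮 (g * h))
    (hone : 𝒮 1 = LinearMap.range (Algebra.linearMap k S)) :
    Function.Bijective (galoisMap h𝒮) := by
  have key (g : G) : ∃ z : 𝒮 g⁻¹ ⊗[k] 𝒮 g,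
      LinearMap.mul' k S (TensorProduct.map (𝒮 g⁻¹).subtype (𝒮 g).subtype z) = 1 := by
    have h : (1 : S) ∈ 𝒮 g⁻¹ * 𝒮 g := by rw [hmul, inv_mul_cancel]; exact h𝒮.one_mem
    have hle : 𝒮 g⁻¹ * 𝒮 g ≤ LinearMap.range
        (LinearMap.mul' k S ∘ₗ TensorProduct.map (𝒮 g⁻¹).subtype (𝒮 g).subtype) :=
      Submodule.mul_le.2 fun u hu v hv => ⟨⟨u, hu⟩ ⊗ₜ ⟨v, hv⟩, rfl⟩
    exact hle h
  choose z hz using key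
  let w (g : G) : S ⊗[k] S := TensorProduct.map (𝒮 g⁻¹).subtype (𝒮 g).subtype (z g)
  -- For `y = u ⊗ v` the product `t u` has degree `e`, hence is a scalar and passes through the
  -- tensor sign: `s t u ⊗ v = s ⊗ t u v`. An arbitrary `y` permits induction; only for `z g` is the
  -- product equal to `1`.
  have hleft (g : G) (t : S) (ht : t ∈ 𝒮 g) (y : 𝒮 g⁻¹ ⊗[k] 𝒮 g) (s : S) :
      (s * t) • TensorProduct.map (𝒮 g⁻¹).subtype (𝒮 g).subtype y = s ⊗ₜ[k]
        (t * LinearMap.mul' k S (TensorProduct.map (𝒮 g⁻¹).subtype (𝒮 g).subtype y)) := by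
    induction y using TensorProduct.induction_on with
    | zero => simp
    | add x y hx hy => rw [map_add, smul_add, hx, hy, map_add, mul_add, TensorProduct.tmul_add]
    | tmul u v =>
      have hu : t * u ∈ 𝒮 1 := by
        rw [← mul_inv_cancel g]; exact h𝒮.mul_mem ht u.2
      rw [hone] at hu
      obtain ⟨c, hc⟩ := hu
      rw [Algebra.linearMap_apply] at hc
      simp only [TensorProduct.map_tmul, Submodule.subtype_apply, LinearMap.mul'_apply,
        TensorProduct.smul_tmul', smul_eq_mul]
      rw [mul_assoc, ← mul_assoc t, ← hc, ← Algebra.commutes, ← Algebra.smul_def,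
        ← Algebra.smul_def, TensorProduct.smul_tmul]
  have hright (g : G) (y : 𝒮 g⁻¹ ⊗[k] 𝒮 g) (s : S) :
      galoisMap h𝒮 (s • TensorProduct.map (𝒮 g⁻¹).subtype (𝒮 g).subtype y) =
        (s * LinearMap.mul' k S (TensorProduct.map (𝒮 g⁻¹).subtype (𝒮 g).subtype y)) ⊗ₜ[k]
          MonoidAlgebra.single g (1 : k) := by
    induction y using TensorProduct.induction_on with
    | zero => simp
    | add x y hx hy =>
      rw [map_add, smul_add, map_add, hx, hy, map_add, mul_add, TensorProduct.add_tmul]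
    | tmul u v =>
      simp only [TensorProduct.map_tmul, Submodule.subtype_apply, LinearMap.mul'_apply,
        TensorProduct.smul_tmul', smul_eq_mul]
      rw [galoisMap_tmul_of_mem h𝒮 _ v.2, mul_assoc]
  let δ : S ⊗[k] MonoidAlgebra k G →ₗ[k] S ⊗[k] S :=
    TensorProduct.lift (LinearMap.flip ((MonoidAlgebra.basis G k).constr k fun g =>
      (LinearMap.toSpanSingleton S (S ⊗[k] S) (w g)).restrictScalars k))
  have hδ (s : S) (g : G) : δ (s ⊗ₜ MonoidAlgebra.single g 1) = s • w g := by
    rw [TensorProduct.lift.tmul, LinearMap.flip_apply, ← MonoidAlgebra.basis_apply,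
      Module.Basis.constr_basis]
    rfl
  refine Function.bijective_iff_has_inverse.2 ⟨δ, fun x => ?_, fun x => ?_⟩
  · suffices h : δ ∘ₗ galoisMap h𝒮 = LinearMap.id from LinearMap.congr_fun h x
    refine TensorProduct.ext (LinearMap.ext fun s => h𝒮.hom_ext fun g t ht => ?_)
    change δ (galoisMap h𝒮 (s ⊗ₜ t)) = s ⊗ₜ t
    rw [galoisMap_tmul_of_mem h𝒮 s ht, hδ, hleft g t ht, hz, mul_one]
  · suffices h : galoisMap h𝒮 ∘ₗ δ = LinearMap.id from LinearMap.congr_fun h x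
    refine TensorProduct.ext (LinearMap.ext fun s => (MonoidAlgebra.basis G k).ext fun g => ?_)
    rw [MonoidAlgebra.basis_apply]
    change galoisMap h𝒮 (δ (s ⊗ₜ MonoidAlgebra.single g 1)) = s ⊗ₜ MonoidAlgebra.single g 1
    rw [hδ, hright, hz, mul_one]

end Galois

end TaylorAzumaya

end

theorem lemma3p1 {k A G : Type u} [CommRing k] [NonUnitalRing A] [Module k A]
    [SMulCommClass k A A] [IsScalarTower k A A] [Group G] [DecidableEq G]
    [DistribMulAction G A] [TaylorAzumaya.IsModuleAlgebra k A G] [TaylorAzumaya.IsTaylorAzumaya k A] :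
    (∀ (φ ψ : TaylorAzumaya.Hl k A G) (a b : A), (φ * ψ).1 (a * b) = φ.1 a * ψ.1 b) ∧
    (∀ a : A, (1 : TaylorAzumaya.Hl k A G).1 a = TaylorAzumaya.Smash.of k 1 a) ∧
    TaylorAzumaya.IsGaloisObject (TaylorAzumaya.Hl.degree k A G) := by
  refine ⟨TaylorAzumaya.EnvHom.mul_apply_mul, fun _ => rfl, TaylorAzumaya.Hl.isGrading_degree,
    TaylorAzumaya.galoisMap_bijective _ TaylorAzumaya.Hl.degree_mul_degree
      TaylorAzumaya.Hl.degree_one,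
    TaylorAzumaya.Hl.degree_mul_degree, TaylorAzumaya.Hl.algebraMap_injective,
    TaylorAzumaya.Hl.degree_one⟩
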